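/- Let $p\ge 1$ and let $C,D\in\mathbb R^{p\times p}$ be such that $C$ has negative diagonal and nonnegative off-diagonal entries, $D$ has nonnegative entries, $D\neq 0$, and $Q=C+D$ is the generator of an irreducible continuous-time Markov chain on $\{1,\dots,p\}$ (row sums $0$; for $p=1$, $Q=0$ is counted as irreducible). Let $(N(t),X(t))_{t\ge 0}$ be a Markovian arrival process with parameters $(\eta,C,D)$, where $\eta$ is an arbitrary probability vector: that is, a time-homogeneous Markov process on $\{0,1,2,\dots\}\times\{1,\dots,p\}$ with $N(0)=0$, $X(0)\sim\eta$, which jumps from $(n,i)$ to $(n,j)$, $j\ne i$, at rate $C_{ij}$ and from $(n,i)$ to $(n+1,j)$ at rate $D_{ij}$. Suppose that the process is a Markov modulated Poisson process (MMPP), i.e. $D$ is diagonal, or a Markovian switched Poisson process (MSPP), i.e. $C$ is diagonal. Then $N(t)$ has finite second moment for every $t\ge0$, the limit $$d^2=\lim_{t\to\infty}\frac{\operatorname{Var}(N(t))}{\mathbb E[N(t)]}$$ exists, and $d^2\ge 1$. -/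

import Mathlib

open MeasureTheory ProbabilityTheory Filter Topology
open scoped NNReal

namespace MarkovArrival

/-- `(C, D)` are the rate matrices of a Markovian arrival process with `p` phases: `C` has negative
diagonal and nonnegative off-diagonal entries (phase changes without an event), `D` is nonnegative
(phase changes with an event), and `Q = C + D` is the generator of an irreducible continuous-time
Markov chain on the phases. -/
structure IsMAPRates {p : ℕ} (C D : Matrix (Fin p) (Fin p) ℝ) : Prop where
  C_diag_neg : ∀ i, C i i < 0
  C_offDiag_nonneg : ∀ i j, i ≠ j → 0 ≤ C i j
  D_nonneg : ∀ i j, 0 ≤ D i j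
  row_sum : ∀ i, ∑ j, (C + D) i j = 0
  irreducible : ∀ i j, Relation.ReflTransGen (fun a b => a ≠ b ∧ 0 < (C + D) a b) i j

/-- `countTrans C D k t i j` is the probability that, started in phase `i`, exactly `k` events
occur in `[0, t]` and the phase at time `t` is `j`. With no event the phase evolves according to
`exp (t C)`; for `k + 1` events one conditions on the first event, which happens at time `t - s`
with (matrix) density `exp ((t - s) C) D`, after which the process starts afresh.
Equivalently, this is the solution of the Kolmogorov equations of the Markov chain on
`ℕ × {1, …, p}` that jumps `(n, i) → (n, j)` at rate `C i j` (for `i ≠ j`) and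
`(n, i) → (n + 1, j)` at rate `D i j`. -/
noncomputable def countTrans {p : ℕ} (C D : Matrix (Fin p) (Fin p) ℝ) :
    ℕ → ℝ → Matrix (Fin p) (Fin p) ℝ
  | 0, t => NormedSpace.exp (t • C)
  | k + 1, t => Matrix.of fun i j =>
      ∫ s in (0 : ℝ)..t, (NormedSpace.exp ((t - s) • C) * D * countTrans C D k s) i j

/-- The transition function of the Markov chain `(N, X)` on `ℕ × {1, …, p}`. -/
noncomputable def mapTrans {p : ℕ} (C D : Matrix (Fin p) (Fin p) ℝ) (t : ℝ)
    (x y : ℕ × Fin p) : ℝ :=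
  if x.1 ≤ y.1 then countTrans C D (y.1 - x.1) t x.2 y.2 else 0

/-- `(N, X)`, defined on the probability space `(Ω, μ)`, is a Markovian arrival process with
parameters `(η, C, D)`: it is a time-homogeneous Markov process on `ℕ × {1, …, p}` with
`N 0 = 0`, with initial phase distribution `η`, and with transition function `mapTrans C D`. The
Markov property is expressed through the finite-dimensional distributions. -/
structure IsMAP {p : ℕ} (C D : Matrix (Fin p) (Fin p) ℝ) (η : Fin p → ℝ)
    {Ω : Type*} [MeasurableSpace Ω] (μ : Measure Ω)
    (N : ℝ≥0 → Ω → ℕ) (X : ℝ≥0 → Ω → Fin p) : Prop where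
  rates : IsMAPRates C D
  init_mem : η ∈ stdSimplex ℝ (Fin p)
  measurable_N : ∀ t, Measurable (N t)
  measurable_X : ∀ t, Measurable (X t)
  law : ∀ (n : ℕ) (t : Fin (n + 1) → ℝ≥0) (x : Fin (n + 1) → ℕ × Fin p),
    t 0 = 0 → Monotone t →
    μ.real {ω | ∀ l, (N (t l) ω, X (t l) ω) = x l} =
      (if (x 0).1 = 0 then η (x 0).2 else 0) *
        ∏ l : Fin n, mapTrans C D ((t l.succ : ℝ) - (t l.castSucc : ℝ)) (x l.castSucc) (x l.succ)

/-- A Markov modulated Poisson process: a Markovian arrival process with diagonal `D`. -/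
def IsMMPP {p : ℕ} (C D : Matrix (Fin p) (Fin p) ℝ) (η : Fin p → ℝ)
    {Ω : Type*} [MeasurableSpace Ω] (μ : Measure Ω)
    (N : ℝ≥0 → Ω → ℕ) (X : ℝ≥0 → Ω → Fin p) : Prop :=
  IsMAP C D η μ N X ∧ D.IsDiag

/-- A Markovian switched Poisson process: a Markovian arrival process with diagonal `C`. -/
def IsMSPP {p : ℕ} (C D : Matrix (Fin p) (Fin p) ℝ) (η : Fin p → ℝ)
    {Ω : Type*} [MeasurableSpace Ω] (μ : Measure Ω)
    (N : ℝ≥0 → Ω → ℕ) (X : ℝ≥0 → Ω → Fin p) : Prop :=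
  IsMAP C D η μ N X ∧ C.IsDiag

/-- The counting process `N` has finite second moments and its index of dispersion of counts
`Var N(t) / E N(t)` converges to `d2` as `t → ∞`. -/
def HasDispersionLimit {Ω : Type*} [MeasurableSpace Ω] (μ : Measure Ω)
    (N : ℝ≥0 → Ω → ℕ) (d2 : ℝ) : Prop :=
  (∀ t, MemLp (fun ω => (N t ω : ℝ)) 2 μ) ∧
    Tendsto (fun t => variance (fun ω => (N t ω : ℝ)) μ / ∫ ω, (N t ω : ℝ) ∂μ) atTop (𝓝 d2)

end MarkovArrival

/-! Write `Q = C + D`, `e` for the all-ones vector, `w` for the stationary vector, `λ = w·De`. The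
vectors `u`, `v` of first and second moments of `N t`, indexed by the initial phase, solve `u' = Qu
+ De` and `v' = Qv + 2Du + De` (`hasDerivAt_weightedCount`; termwise differentiation rests on the
factorial bound `exists_norm_countProb_le`).

Let `g` solve the Poisson equation `Qg = λe - De`, `w·g = 0`. Then `u = tλe + g - f`, where `f' =
Qf` and `w·f = 0`, so `f` decays exponentially by the Poincaré inequality. Likewise `v = t²λ²e +
t(2λg + ce) + b + r` with `r` bounded and `c = λ + 2 w·Dg`. The `t²` terms and the dependence on `η`
cancel at leading order in the variance, and the ratio tends to `c/λ = 1 + 2(w·Dg)/λ`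
(`exists_tendsto_dispersion`).

It remains to see that `w·Dg ≥ 0` (`dotProduct_mulVec_nonneg`). In both the MMPP and the MSPP case
`w·Dg = ∑ w i (De) i g i`. By the Poisson equation this equals `-⟨g, Qg⟩_w`, a Dirichlet form, hence
nonnegative. -/

open scoped Matrix

namespace MarkovArrival

/-! ### Irreducible generators: stationary vector, Dirichlet form, Poisson equation -/

section Generator

/-- `Q` is the generator of an irreducible continuous-time Markov chain. -/
structure IsIrreducibleGenerator {p : ℕ} (Q : Matrix (Fin p) (Fin p) ℝ) : Prop where
  offDiag_nonneg : ∀ i j, i ≠ j → 0 ≤ Q i j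
  row_sum : ∀ i, ∑ j, Q i j = 0
  irreducible : ∀ i j, Relation.ReflTransGen (fun a b => a ≠ b ∧ 0 < Q a b) i j

/-- `w` is a strictly positive stationary probability vector of `Q`. -/
structure IsStationary {p : ℕ} (Q : Matrix (Fin p) (Fin p) ℝ) (w : Fin p → ℝ) : Prop where
  pos : ∀ i, 0 < w i
  sum_eq_one : ∑ i, w i = 1
  vecMul_eq_zero : w ᵥ* Q = 0

theorem IsMAPRates.isIrreducibleGenerator {p : ℕ} {C D : Matrix (Fin p) (Fin p) ℝ}
    (h : IsMAPRates C D) : IsIrreducibleGenerator (C + D) where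
  offDiag_nonneg i j hij := add_nonneg (h.C_offDiag_nonneg i j hij) (h.D_nonneg i j)
  row_sum := h.row_sum
  irreducible := h.irreducible

variable {p : ℕ} {Q : Matrix (Fin p) (Fin p) ℝ} {w : Fin p → ℝ}

theorem IsIrreducibleGenerator.mulVec_const (hQ : IsIrreducibleGenerator Q) (c : ℝ) :
    Q *ᵥ (fun _ => c) = 0 := by
  ext i
  simp [Matrix.mulVec, dotProduct, ← Finset.sum_mul, hQ.row_sum]

/-- `Q` kills constants, so it has a left null vector `x`. By the triangle inequality `|x| Q ≥ 0`
entrywise; its entries sum to zero because row sums vanish, so `|x|` is a left null vector too. -/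
theorem IsIrreducibleGenerator.exists_isStationary [NeZero p] (hQ : IsIrreducibleGenerator Q) :
    ∃ w, IsStationary Q w := by
  have hdet : Q.det = 0 := by
    refine Matrix.exists_mulVec_eq_zero_iff.mp ⟨fun _ => 1, ?_, hQ.mulVec_const 1⟩
    intro h
    simpa using congrFun h 0
  obtain ⟨x, hx0, hx⟩ := Matrix.exists_vecMul_eq_zero_iff.mpr hdet
  have hcol : ∀ j, ∑ i, x i * Q i j = 0 := fun j => congrFun hx j
  have hge : ∀ j, 0 ≤ ∑ i, |x i| * Q i j := by
    intro j
    have h1 := hcol j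
    rw [← Finset.add_sum_erase _ _ (Finset.mem_univ j)] at h1 ⊢
    have h2 : |∑ i ∈ Finset.univ.erase j, x i * Q i j|
        ≤ ∑ i ∈ Finset.univ.erase j, |x i| * Q i j := by
      refine (Finset.abs_sum_le_sum_abs _ _).trans (Finset.sum_le_sum fun i hi => ?_)
      rw [abs_mul, abs_of_nonneg (hQ.offDiag_nonneg i j (Finset.ne_of_mem_erase hi))]
    have h3 : ∑ i ∈ Finset.univ.erase j, x i * Q i j = -(x j * Q j j) := by linarith
    rw [h3, abs_neg, abs_mul] at h2
    have h4 := mul_le_mul_of_nonneg_left (neg_abs_le (Q j j)) (abs_nonneg (x j))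
    linarith
  have hsum : ∑ j, ∑ i, |x i| * Q i j = 0 := by
    rw [Finset.sum_comm]
    simp [← Finset.mul_sum, hQ.row_sum]
  have habs : ∀ j, ∑ i, |x i| * Q i j = 0 := fun j =>
    (Finset.sum_eq_zero_iff_of_nonneg fun j _ => hge j).mp hsum j (Finset.mem_univ j)
  -- If `x b = 0`, the sum over column `b` has only nonnegative terms, so each vanishes; zeros thus
  -- spread backwards along transitions.
  have hback : ∀ a b, a ≠ b ∧ 0 < Q a b → x b = 0 → x a = 0 := by
    intro a b hab hb
    have h1 := habs b
    have h2 : ∀ i ∈ Finset.univ, 0 ≤ |x i| * Q i b := by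
      intro i _
      by_cases hib : i = b
      · simp [hib, hb]
      · exact mul_nonneg (abs_nonneg _) (hQ.offDiag_nonneg i b hib)
    have h3 := (Finset.sum_eq_zero_iff_of_nonneg h2).mp h1 a (Finset.mem_univ a)
    simpa [hab.2.ne'] using h3
  have hne : ∀ j, x j ≠ 0 := by
    intro j hj
    apply hx0
    ext i
    have := hQ.irreducible i j
    induction this using Relation.ReflTransGen.head_induction_on with
    | refl => exact hj
    | head h _ ih => exact hback _ _ h ih
  have hpos : 0 < ∑ i, |x i| :=
    Finset.sum_pos (fun i _ => abs_pos.mpr (hne i)) ⟨0, Finset.mem_univ _⟩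
  refine ⟨fun i => |x i| / ∑ i, |x i|, fun i => div_pos (abs_pos.mpr (hne i)) hpos, ?_, ?_⟩
  · rw [← Finset.sum_div, div_self hpos.ne']
  · ext j
    have h5 : ∑ i, |x i| / (∑ i, |x i|) * Q i j = (∑ i, |x i| * Q i j) / ∑ i, |x i| := by
      rw [Finset.sum_div]
      exact Finset.sum_congr rfl fun i _ => by ring
    simpa [Matrix.vecMul, dotProduct, habs j] using h5

/-- The weighted inner product `∑ i, w i * f i * g i`. -/
def wInner {p : ℕ} (w f g : Fin p → ℝ) : ℝ := ∑ i, w i * (f i * g i)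

theorem IsStationary.dotProduct_mulVec (hw : IsStationary Q w) (f : Fin p → ℝ) :
    w ⬝ᵥ (Q *ᵥ f) = 0 := by
  rw [Matrix.dotProduct_mulVec, hw.vecMul_eq_zero, zero_dotProduct]

theorem IsStationary.dotProduct_const (hw : IsStationary Q w) (c : ℝ) :
    w ⬝ᵥ (fun _ => c) = c := by
  simp [dotProduct, ← Finset.sum_mul, hw.sum_eq_one]

theorem IsStationary.wInner_self_nonneg (hw : IsStationary Q w) (f : Fin p → ℝ) :
    0 ≤ wInner w f f :=
  Finset.sum_nonneg fun i _ => mul_nonneg (hw.pos i).le (mul_self_nonneg _)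

/-- On expanding the square, the `f i ^ 2` part dies by zero row sums and the `f j ^ 2` part by
stationarity. Reversibility is not needed. -/
theorem IsStationary.wInner_mulVec_self (hw : IsStationary Q w) (hQ : IsIrreducibleGenerator Q)
    (f : Fin p → ℝ) :
    -wInner w f (Q *ᵥ f) = 1 / 2 * ∑ i, ∑ j, w i * Q i j * (f i - f j) ^ 2 := by
  have h1 : ∑ i, ∑ j, w i * Q i j * f i ^ 2 = 0 := by
    refine Finset.sum_eq_zero fun i _ => ?_
    rw [← Finset.sum_mul, ← Finset.mul_sum, hQ.row_sum]
    simp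
  have h2 : ∑ i, ∑ j, w i * Q i j * f j ^ 2 = 0 := by
    rw [Finset.sum_comm]
    refine Finset.sum_eq_zero fun j _ => ?_
    rw [← Finset.sum_mul]
    have : ∑ i, w i * Q i j = 0 := congrFun hw.vecMul_eq_zero j
    rw [this, zero_mul]
  have h3 : wInner w f (Q *ᵥ f) = ∑ i, ∑ j, w i * Q i j * (f i * f j) := by
    simp only [wInner, Matrix.mulVec, dotProduct, Finset.mul_sum]
    exact Finset.sum_congr rfl fun i _ => Finset.sum_congr rfl fun j _ => by ring
  have h4 : ∑ i, ∑ j, w i * Q i j * (f i - f j) ^ 2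
      = ∑ i, ∑ j, w i * Q i j * f i ^ 2 + ∑ i, ∑ j, w i * Q i j * f j ^ 2
        - 2 * ∑ i, ∑ j, w i * Q i j * (f i * f j) := by
    simp only [Finset.mul_sum, ← Finset.sum_add_distrib, ← Finset.sum_sub_distrib]
    exact Finset.sum_congr rfl fun i _ => Finset.sum_congr rfl fun j _ => by ring
  rw [h4, h1, h2, h3]
  ring

theorem IsStationary.dirichlet_term_nonneg (hw : IsStationary Q w)
    (hQ : IsIrreducibleGenerator Q) (f : Fin p → ℝ) (i j : Fin p) :
    0 ≤ w i * Q i j * (f i - f j) ^ 2 := by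
  by_cases hij : i = j
  · simp [hij]
  · exact mul_nonneg (mul_nonneg (hw.pos i).le (hQ.offDiag_nonneg i j hij)) (sq_nonneg _)

theorem IsStationary.wInner_mulVec_self_nonpos (hw : IsStationary Q w)
    (hQ : IsIrreducibleGenerator Q) (f : Fin p → ℝ) : wInner w f (Q *ᵥ f) ≤ 0 := by
  have h1 := hw.wInner_mulVec_self hQ f
  have h2 : 0 ≤ ∑ i, ∑ j, w i * Q i j * (f i - f j) ^ 2 :=
    Finset.sum_nonneg fun i _ => Finset.sum_nonneg fun j _ => hw.dirichlet_term_nonneg hQ f i j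
  linarith

/-- Every term of the Dirichlet form vanishes, so `f` is constant along each positive-rate
transition; irreducibility joins all states. -/
theorem IsStationary.eq_of_wInner_mulVec_self_eq_zero (hw : IsStationary Q w)
    (hQ : IsIrreducibleGenerator Q) {f : Fin p → ℝ} (hf : wInner w f (Q *ᵥ f) = 0)
    (i j : Fin p) : f i = f j := by
  have h1 := hw.wInner_mulVec_self hQ f
  have h2 : ∑ i, ∑ j, w i * Q i j * (f i - f j) ^ 2 = 0 := by linarith
  have h3 : ∀ a b, w a * Q a b * (f a - f b) ^ 2 = 0 := by
    intro a b
    have h4 := (Finset.sum_eq_zero_iff_of_nonneg fun i _ =>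
      Finset.sum_nonneg fun j _ => hw.dirichlet_term_nonneg hQ f i j).mp h2 a (Finset.mem_univ a)
    exact (Finset.sum_eq_zero_iff_of_nonneg fun j _ =>
      hw.dirichlet_term_nonneg hQ f a j).mp h4 b (Finset.mem_univ b)
  have h5 : ∀ a b, a ≠ b ∧ 0 < Q a b → f a = f b := by
    intro a b hab
    have := h3 a b
    have h6 := (mul_pos (hw.pos a) hab.2).ne'
    have h7 : (f a - f b) ^ 2 = 0 := (mul_eq_zero.mp this).resolve_left h6
    exact sub_eq_zero.mp (pow_eq_zero_iff two_ne_zero |>.mp h7)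
  induction hQ.irreducible i j with
  | refl => rfl
  | tail _ h ih => exact ih.trans (h5 _ _ h)

theorem IsStationary.wInner_self_le (hw : IsStationary Q w) (f : Fin p → ℝ) :
    wInner w f f ≤ ‖f‖ ^ 2 := by
  calc wInner w f f ≤ ∑ i, w i * ‖f‖ ^ 2 := by
        refine Finset.sum_le_sum fun i _ => mul_le_mul_of_nonneg_left ?_ (hw.pos i).le
        have := norm_le_pi_norm f i
        rw [← sq, ← sq_abs]
        exact pow_le_pow_left₀ (abs_nonneg _) this 2
    _ = ‖f‖ ^ 2 := by rw [← Finset.sum_mul, hw.sum_eq_one, one_mul]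

/-- Poincaré inequality for an irreducible generator. -/
theorem IsStationary.exists_spectral_gap (hw : IsStationary Q w) (hQ : IsIrreducibleGenerator Q) :
    ∃ γ, 0 < γ ∧ ∀ f, w ⬝ᵥ f = 0 → wInner w f (Q *ᵥ f) ≤ -(γ * wInner w f f) := by
  have hdot : Continuous fun f : Fin p → ℝ => w ⬝ᵥ f := by unfold dotProduct; fun_prop
  have hform : Continuous fun f : Fin p → ℝ => wInner w f (Q *ᵥ f) := by
    unfold wInner Matrix.mulVec dotProduct; fun_prop
  let K : Set (Fin p → ℝ) := Metric.sphere 0 1 ∩ {f | w ⬝ᵥ f = 0}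
  have hK : IsCompact K := (isCompact_sphere 0 1).inter_right (isClosed_eq hdot continuous_const)
  have hgap : ∃ γ, 0 < γ ∧ ∀ f ∈ K, wInner w f (Q *ᵥ f) ≤ -γ := by
    -- `K` is empty when `p = 1`. Otherwise the form attains its maximum on `K`, and a zero maximum
    -- would force a constant, mean-zero, hence null maximiser.
    rcases K.eq_empty_or_nonempty with h | h
    · exact ⟨1, one_pos, by simp [h]⟩
    obtain ⟨m, hm, hmax⟩ := hK.exists_isMaxOn h hform.continuousOn
    refine ⟨-wInner w m (Q *ᵥ m), ?_, fun f hf => by simpa using hmax hf⟩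
    rw [neg_pos]
    refine lt_of_le_of_ne (hw.wInner_mulVec_self_nonpos hQ m) fun h0 => ?_
    have hc := hw.eq_of_wInner_mulVec_self_eq_zero hQ h0
    have hm0 : m = 0 := by
      ext i
      have h1 : m = fun _ => m i := funext fun j => hc j i
      have h2 : w ⬝ᵥ m = 0 := hm.2
      rw [h1, hw.dotProduct_const] at h2
      simpa using h2
    have := hm.1
    simp [hm0] at this
  obtain ⟨γ, hγ, hle⟩ := hgap
  refine ⟨γ, hγ, fun f hf => ?_⟩
  by_cases hf0 : f = 0
  · simp [hf0, wInner]
  have hn : 0 < ‖f‖ := norm_pos_iff.mpr hf0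
  have h1 := hle (‖f‖⁻¹ • f) ⟨by simp [norm_smul, hn.ne'], by simp [hf]⟩
  have h2 : wInner w (‖f‖⁻¹ • f) (Q *ᵥ (‖f‖⁻¹ • f)) = ‖f‖⁻¹ ^ 2 * wInner w f (Q *ᵥ f) := by
    simp only [wInner, Matrix.mulVec_smul, Pi.smul_apply, smul_eq_mul, Finset.mul_sum]
    exact Finset.sum_congr rfl fun i _ => by ring
  rw [h2] at h1
  have h3 : wInner w f (Q *ᵥ f) = ‖f‖ ^ 2 * (‖f‖⁻¹ ^ 2 * wInner w f (Q *ᵥ f)) := by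
    field_simp
  rw [h3]
  have h4 := mul_le_mul_of_nonneg_left h1 (sq_nonneg ‖f‖)
  have h5 := mul_le_mul_of_nonneg_left (hw.wInner_self_le f) hγ.le
  linarith

/-- Fredholm alternative for the Poisson equation; it supplies both correction vectors `g` and `b`
of the moment expansions. -/
theorem IsStationary.exists_mulVec_eq (hw : IsStationary Q w) (hQ : IsIrreducibleGenerator Q)
    {y : Fin p → ℝ} (hy : w ⬝ᵥ y = 0) : ∃ x, w ⬝ᵥ x = 0 ∧ Q *ᵥ x = y := by
  -- `x ↦ Q x + (w ⬝ x) e` is injective, hence bijective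
  let T : (Fin p → ℝ) →ₗ[ℝ] (Fin p → ℝ) :=
    { toFun := fun x => Q *ᵥ x + fun _ => w ⬝ᵥ x
      map_add' := fun a b => by
        ext i; simp [Matrix.mulVec_add]; ring
      map_smul' := fun c a => by
        ext i; simp [Matrix.mulVec_smul]; ring }
  have hT : ∀ x, T x = Q *ᵥ x + fun _ => w ⬝ᵥ x := fun _ => rfl
  have hdot : ∀ x, w ⬝ᵥ T x = w ⬝ᵥ x := by
    intro x
    rw [hT, dotProduct_add, hw.dotProduct_mulVec, hw.dotProduct_const, zero_add]
  have hinj : Function.Injective T := by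
    rw [← LinearMap.ker_eq_bot, LinearMap.ker_eq_bot']
    intro x hx
    have h1 : w ⬝ᵥ x = 0 := by rw [← hdot, hx, dotProduct_zero]
    have h2 : Q *ᵥ x = 0 := by
      have := hT x
      rw [hx, h1] at this
      ext i
      simpa using (congrFun this i).symm
    have hc := hw.eq_of_wInner_mulVec_self_eq_zero hQ (f := x) (by simp [h2, wInner])
    ext i
    have h3 : x = fun _ => x i := funext fun j => hc j i
    rw [h3, hw.dotProduct_const] at h1
    simpa using h1
  obtain ⟨x, hx⟩ := LinearMap.injective_iff_surjective.mp hinj y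
  have h1 : w ⬝ᵥ x = 0 := by rw [← hdot, hx, hy]
  refine ⟨x, h1, ?_⟩
  rw [← hx, hT, h1]
  ext i
  simp

end Generator

/-! ### Kolmogorov equations and factorial bounds for the counting probabilities -/

section CountTrans

attribute [local instance] Matrix.linftyOpNormedRing Matrix.linftyOpNormedAlgebra

variable {p : ℕ} (C D : Matrix (Fin p) (Fin p) ℝ)

theorem hasDerivAt_matrix {ι κ : Type*} [Fintype ι] [Fintype κ] {F : ℝ → Matrix ι κ ℝ}
    {F' : Matrix ι κ ℝ} {t : ℝ} (h : ∀ i j, HasDerivAt (fun s => F s i j) (F' i j) t) :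
    HasDerivAt F F' t :=
  hasDerivAt_pi.mpr fun i => hasDerivAt_pi.mpr fun j => h i j

theorem hasDerivAt_exp_smul_matrix (t : ℝ) :
    HasDerivAt (fun s : ℝ => NormedSpace.exp (s • C)) (C * NormedSpace.exp (t • C)) t :=
  hasDerivAt_exp_smul_const' C t

theorem continuous_exp_smul_matrix :
    Continuous fun s : ℝ => NormedSpace.exp (s • C) :=
  continuous_iff_continuousAt.mpr fun t => (hasDerivAt_exp_smul_matrix C t).continuousAt

theorem exp_sub_smul_matrix (t s : ℝ) :
    NormedSpace.exp ((t - s) • C) = NormedSpace.exp (t • C) * NormedSpace.exp (-s • C) := by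
  rw [sub_eq_add_neg, add_smul]
  exact Matrix.exp_add_of_commute _ _ (((Commute.refl C).smul_left t).smul_right (-s))

theorem exp_smul_mul_exp_neg_smul_matrix (t : ℝ) :
    NormedSpace.exp (t • C) * NormedSpace.exp (-t • C) = 1 := by
  rw [← exp_sub_smul_matrix, sub_self, zero_smul, NormedSpace.exp_zero]

/-- Factoring `exp ((t - s) C) = exp (t C) exp (-s C)` takes `t` out of the integrand, leaving the
product rule and the fundamental theorem of calculus. -/
theorem hasDerivAt_integral_exp_mul {P : ℝ → Matrix (Fin p) (Fin p) ℝ} (hP : Continuous P)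
    (t : ℝ) :
    HasDerivAt (fun t : ℝ => Matrix.of fun i j =>
      ∫ s in (0 : ℝ)..t, (NormedSpace.exp ((t - s) • C) * D * P s) i j)
      (C * (Matrix.of fun i j =>
        ∫ s in (0 : ℝ)..t, (NormedSpace.exp ((t - s) • C) * D * P s) i j) + D * P t) t := by
  let R : ℝ → Matrix (Fin p) (Fin p) ℝ := fun t => Matrix.of fun i j =>
    ∫ s in (0 : ℝ)..t, (NormedSpace.exp (-s • C) * D * P s) i j
  have hcont : ∀ i j, Continuous fun s : ℝ => (NormedSpace.exp (-s • C) * D * P s) i j := by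
    intro i j
    have h1 : Continuous fun s : ℝ => NormedSpace.exp (-s • C) :=
      (continuous_exp_smul_matrix C).comp continuous_neg
    exact ((h1.mul continuous_const).mul hP).matrix_elem i j
  have heq : ∀ t, (Matrix.of fun i j =>
      ∫ s in (0 : ℝ)..t, (NormedSpace.exp ((t - s) • C) * D * P s) i j)
      = NormedSpace.exp (t • C) * R t := by
    intro t
    ext i j
    simp only [Matrix.of_apply, R, exp_sub_smul_matrix, Matrix.mul_assoc]
    simp only [Matrix.mul_apply (M := NormedSpace.exp (t • C)), Matrix.of_apply]
    rw [intervalIntegral.integral_finsetSum]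
    · simp only [intervalIntegral.integral_const_mul]
    · intro a _
      have := hcont a j
      simp only [Matrix.mul_assoc] at this
      exact (this.const_mul _).intervalIntegrable _ _
  have hR : HasDerivAt R (NormedSpace.exp (-t • C) * D * P t) t :=
    hasDerivAt_matrix fun i j => (hcont i j).integral_hasStrictDerivAt 0 t |>.hasDerivAt
  have h := (hasDerivAt_exp_smul_matrix C t).mul hR
  have h2 : C * NormedSpace.exp (t • C) * R t
      + NormedSpace.exp (t • C) * (NormedSpace.exp (-t • C) * D * P t)
      = C * (NormedSpace.exp (t • C) * R t) + D * P t := by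
    rw [← Matrix.mul_assoc (NormedSpace.exp (t • C)), ← Matrix.mul_assoc (NormedSpace.exp (t • C)),
      exp_smul_mul_exp_neg_smul_matrix, Matrix.one_mul, Matrix.mul_assoc]
  rw [heq t, ← h2]
  exact h.congr_of_eventuallyEq (Eventually.of_forall heq)

theorem continuous_countTrans (k : ℕ) : Continuous (countTrans C D k) := by
  induction k with
  | zero => exact continuous_exp_smul_matrix C
  | succ k ih =>
    exact continuous_iff_continuousAt.mpr fun t =>
      (hasDerivAt_integral_exp_mul C D ih t).continuousAt

theorem hasDerivAt_countTrans_zero (t : ℝ) :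
    HasDerivAt (countTrans C D 0) (C * countTrans C D 0 t) t :=
  hasDerivAt_exp_smul_matrix C t

theorem hasDerivAt_countTrans_succ (k : ℕ) (t : ℝ) :
    HasDerivAt (countTrans C D (k + 1))
      (C * countTrans C D (k + 1) t + D * countTrans C D k t) t :=
  hasDerivAt_integral_exp_mul C D (continuous_countTrans C D k) t

/-- The vector of probabilities of exactly `k` events in `[0, t]`, indexed by the initial phase. -/
noncomputable def countProb (k : ℕ) (t : ℝ) : Fin p → ℝ := countTrans C D k t *ᵥ 1

theorem hasDerivAt_mulVec_one {F : ℝ → Matrix (Fin p) (Fin p) ℝ}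
    {F' : Matrix (Fin p) (Fin p) ℝ} {t : ℝ} (h : HasDerivAt F F' t) :
    HasDerivAt (fun s => F s *ᵥ (1 : Fin p → ℝ)) (F' *ᵥ 1) t := by
  have h' : ∀ i j, HasDerivAt (fun s => F s i j) (F' i j) t := fun i j =>
    hasDerivAt_pi.mp (hasDerivAt_pi.mp h i) j
  refine hasDerivAt_pi.mpr fun i => ?_
  simp only [Matrix.mulVec, dotProduct, Pi.one_apply, mul_one]
  exact HasDerivAt.fun_sum fun j _ => h' i j

theorem hasDerivAt_countProb_zero (t : ℝ) :
    HasDerivAt (countProb C D 0) (C *ᵥ countProb C D 0 t) t := by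
  have := hasDerivAt_mulVec_one (hasDerivAt_countTrans_zero C D t)
  rwa [← Matrix.mulVec_mulVec] at this

theorem hasDerivAt_countProb_succ (k : ℕ) (t : ℝ) :
    HasDerivAt (countProb C D (k + 1))
      (C *ᵥ countProb C D (k + 1) t + D *ᵥ countProb C D k t) t := by
  have := hasDerivAt_mulVec_one (hasDerivAt_countTrans_succ C D k t)
  rwa [Matrix.add_mulVec, ← Matrix.mulVec_mulVec, ← Matrix.mulVec_mulVec] at this

theorem countProb_zero_zero : countProb C D 0 0 = 1 := by
  simp [countProb, countTrans]

theorem countProb_succ_zero (k : ℕ) : countProb C D (k + 1) 0 = 0 := by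
  ext i
  simp [countProb, countTrans, Matrix.mulVec, dotProduct]

theorem countProb_succ_apply (k : ℕ) (t : ℝ) (i : Fin p) :
    countProb C D (k + 1) t i
      = ∫ s in (0 : ℝ)..t, (NormedSpace.exp ((t - s) • C) *ᵥ (D *ᵥ countProb C D k s)) i := by
  have hcont : ∀ i j, Continuous fun s : ℝ =>
      (NormedSpace.exp ((t - s) • C) * D * countTrans C D k s) i j := by
    intro i j
    have h1 : Continuous fun s : ℝ => NormedSpace.exp ((t - s) • C) :=
      (continuous_exp_smul_matrix C).comp (continuous_const.sub continuous_id)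
    exact ((h1.mul continuous_const).mul (continuous_countTrans C D k)).matrix_elem i j
  have h1 : countProb C D (k + 1) t i = ∑ j, ∫ s in (0 : ℝ)..t,
      (NormedSpace.exp ((t - s) • C) * D * countTrans C D k s) i j := by
    simp [countProb, countTrans, Matrix.mulVec, dotProduct]
  rw [h1, ← intervalIntegral.integral_finsetSum fun j _ => (hcont i j).intervalIntegrable _ _]
  refine intervalIntegral.integral_congr fun s _ => ?_
  simp only [countProb, Matrix.mulVec_mulVec]
  simp [Matrix.mulVec, dotProduct, Matrix.mul_assoc]

/-- Each event costs one integration, so `k` events give `|t| ^ k / k!`. Negative times are included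
because two-sided derivatives are taken, also at `0`. -/
theorem exists_norm_countProb_le (T : ℝ) :
    ∃ A B : ℝ, 0 ≤ A ∧ 0 ≤ B ∧ ∀ k t, |t| ≤ T →
      ‖countProb C D k t‖ ≤ A * (B ^ k * |t| ^ k / k.factorial) := by
  -- The exponent `t - s` with `|t|, |s| ≤ T` ranges over `[-2T, 2T]`.
  obtain ⟨M, hM⟩ := (isCompact_Icc (a := -(2 * T)) (b := 2 * T)).exists_bound_of_continuousOn
    (continuous_exp_smul_matrix C).continuousOn
  rcases lt_or_ge T 0 with hT | hT
  · exact ⟨0, 0, le_rfl, le_rfl, fun k t ht => absurd ((abs_nonneg t).trans ht) (not_le.mpr hT)⟩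
  have hM0 : 0 ≤ M := (norm_nonneg _).trans (hM 0 ⟨by linarith, by linarith⟩)
  refine ⟨M, M * ‖D‖, hM0, mul_nonneg hM0 (norm_nonneg _), fun k => ?_⟩
  induction k with
  | zero =>
    intro t ht
    have ht' := abs_le.mp ht
    have h1 : ‖(1 : Fin p → ℝ)‖ ≤ 1 := (pi_norm_le_iff_of_nonneg zero_le_one).mpr (by simp)
    calc ‖countProb C D 0 t‖ ≤ ‖NormedSpace.exp (t • C)‖ * ‖(1 : Fin p → ℝ)‖ :=
          Matrix.linfty_opNorm_mulVec _ _
      _ ≤ M * 1 := mul_le_mul (hM t ⟨by linarith, by linarith⟩) h1 (norm_nonneg _) hM0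
      _ = _ := by simp
  | succ k ih =>
    intro t ht
    have ht' := abs_le.mp ht
    have hA : 0 ≤ M * ((M * ‖D‖) ^ (k + 1) * |t| ^ (k + 1) / (k + 1).factorial) := by positivity
    refine (pi_norm_le_iff_of_nonneg hA).mpr fun i => ?_
    rw [countProb_succ_apply]
    have hbd : ∀ s ∈ Set.uIoc 0 t,
        ‖(NormedSpace.exp ((t - s) • C) *ᵥ (D *ᵥ countProb C D k s)) i‖
          ≤ M * (M * ‖D‖) ^ (k + 1) / k.factorial * |s - 0| ^ k := by
      intro s hs
      have hs1 : |s| ≤ |t| := by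
        have := Set.abs_sub_left_of_mem_uIcc (Set.uIoc_subset_uIcc hs)
        simpa using this
      have hs2 := abs_le.mp (hs1.trans ht)
      have h3 : ‖D *ᵥ countProb C D k s‖
          ≤ ‖D‖ * (M * ((M * ‖D‖) ^ k * |s| ^ k / k.factorial)) :=
        (Matrix.linfty_opNorm_mulVec _ _).trans
          (mul_le_mul_of_nonneg_left (ih s (hs1.trans ht)) (norm_nonneg _))
      calc _ ≤ ‖NormedSpace.exp ((t - s) • C) *ᵥ (D *ᵥ countProb C D k s)‖ := norm_le_pi_norm _ i
        _ ≤ ‖NormedSpace.exp ((t - s) • C)‖ * ‖D *ᵥ countProb C D k s‖ :=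
            Matrix.linfty_opNorm_mulVec _ _
        _ ≤ M * (‖D‖ * (M * ((M * ‖D‖) ^ k * |s| ^ k / k.factorial))) :=
            mul_le_mul (hM _ ⟨by linarith, by linarith⟩) h3 (norm_nonneg _) hM0
        _ = _ := by rw [sub_zero]; ring
    rw [intervalIntegral.norm_intervalIntegral_eq]
    refine (norm_integral_le_of_norm_le (g := fun s => M * (M * ‖D‖) ^ (k + 1) / k.factorial *
      |s - 0| ^ k) ?_ ?_).trans ?_
    · have : Continuous fun s : ℝ => M * (M * ‖D‖) ^ (k + 1) / k.factorial * |s - 0| ^ k := by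
        fun_prop
      exact (this.integrableOn_uIcc).mono_set Set.uIoc_subset_uIcc
    · exact (ae_restrict_iff' measurableSet_uIoc).mpr (Eventually.of_forall hbd)
    · rw [integral_const_mul, integral_pow_abs_sub_uIoc, sub_zero, Nat.factorial_succ]
      apply le_of_eq
      push_cast
      field_simp

end CountTrans

/-! ### Moment vectors and their differential equations -/

section WeightedCount

/-- The weights `c` grow at most geometrically. -/
def GeomBounded (c : ℕ → ℝ) : Prop := ∃ a r : ℝ, 0 ≤ a ∧ 0 ≤ r ∧ ∀ k, |c k| ≤ a * r ^ k

theorem GeomBounded.shift {c : ℕ → ℝ} (h : GeomBounded c) : GeomBounded fun k => c (k + 1) := by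
  obtain ⟨a, r, ha, hr, h⟩ := h
  exact ⟨a * r, r, mul_nonneg ha hr, hr, fun k => (h (k + 1)).trans_eq (by ring)⟩

theorem geomBounded_one : GeomBounded fun _ => 1 :=
  ⟨1, 1, zero_le_one, zero_le_one, fun k => by simp⟩

theorem geomBounded_natCast : GeomBounded fun k => (k : ℝ) :=
  ⟨1, 2, zero_le_one, zero_le_two, fun k => by
    rw [Nat.abs_cast, one_mul]
    exact_mod_cast (Nat.lt_two_pow_self (n := k)).le⟩

theorem geomBounded_natCast_sq : GeomBounded fun k => (k : ℝ) ^ 2 :=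
  ⟨1, 4, zero_le_one, by norm_num, fun k => by
    have h : (k : ℝ) ≤ 2 ^ k := by exact_mod_cast (Nat.lt_two_pow_self (n := k)).le
    have h2 := pow_le_pow_left₀ (Nat.cast_nonneg k) h 2
    rw [abs_of_nonneg (sq_nonneg _), one_mul]
    calc (k : ℝ) ^ 2 ≤ (2 ^ k) ^ 2 := h2
      _ = 4 ^ k := by rw [← pow_mul, mul_comm, pow_mul]; norm_num⟩

theorem GeomBounded.summable_mul {c : ℕ → ℝ} (h : GeomBounded c) (A x : ℝ) (hA : 0 ≤ A)
    (hx : 0 ≤ x) : Summable fun k => |c k| * (A * (x ^ k / k.factorial)) := by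
  obtain ⟨a, r, ha, hr, h⟩ := h
  refine Summable.of_nonneg_of_le (fun k => by positivity) (fun k => ?_)
    ((Real.summable_pow_div_factorial (r * x)).mul_left (a * A))
  calc |c k| * (A * (x ^ k / k.factorial)) ≤ a * r ^ k * (A * (x ^ k / k.factorial)) :=
        mul_le_mul_of_nonneg_right (h k) (by positivity)
    _ = _ := by rw [mul_pow]; ring

variable {p : ℕ} (C D : Matrix (Fin p) (Fin p) ℝ)

/-- The vector `∑ k, c k * P(N t = k)`, indexed by the initial phase. -/
noncomputable def weightedCount (c : ℕ → ℝ) (t : ℝ) : Fin p → ℝ := ∑' k, c k • countProb C D k t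

theorem exists_norm_countProb_le_of_abs_le (T : ℝ) (hT : 0 ≤ T) :
    ∃ A x : ℝ, 0 ≤ A ∧ 0 ≤ x ∧ ∀ k t, |t| ≤ T →
      ‖countProb C D k t‖ ≤ A * (x ^ k / k.factorial) := by
  obtain ⟨A, B, hA, hB, h⟩ := exists_norm_countProb_le C D T
  refine ⟨A, B * T, hA, mul_nonneg hB hT, fun k t ht => (h k t ht).trans ?_⟩
  rw [mul_pow]
  gcongr

theorem summable_norm_smul_countProb {c : ℕ → ℝ} (hc : GeomBounded c) (t : ℝ) :
    Summable fun k => ‖c k • countProb C D k t‖ := by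
  obtain ⟨A, x, hA, hx, h⟩ := exists_norm_countProb_le_of_abs_le C D |t| (abs_nonneg t)
  refine Summable.of_nonneg_of_le (fun k => norm_nonneg _) (fun k => ?_) (hc.summable_mul A x hA hx)
  rw [norm_smul]
  exact mul_le_mul_of_nonneg_left (h k t le_rfl) (abs_nonneg _)

theorem summable_smul_countProb {c : ℕ → ℝ} (hc : GeomBounded c) (t : ℝ) :
    Summable fun k => c k • countProb C D k t :=
  (summable_norm_smul_countProb C D hc t).of_norm

theorem weightedCount_zero (c : ℕ → ℝ) : weightedCount C D c 0 = fun _ => c 0 := by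
  rw [weightedCount, tsum_eq_single 0]
  · ext i; simp [countProb_zero_zero]
  · intro k hk
    obtain ⟨k, rfl⟩ := Nat.exists_eq_succ_of_ne_zero hk
    simp [countProb_succ_zero]

theorem weightedCount_add {c d : ℕ → ℝ} (hc : GeomBounded c) (hd : GeomBounded d) (t : ℝ) :
    weightedCount C D (fun k => c k + d k) t = weightedCount C D c t + weightedCount C D d t := by
  simp only [weightedCount, add_smul]
  exact (summable_smul_countProb C D hc t).tsum_add (summable_smul_countProb C D hd t)

theorem weightedCount_const_mul (a : ℝ) {c : ℕ → ℝ} (hc : GeomBounded c) (t : ℝ) :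
    weightedCount C D (fun k => a * c k) t = a • weightedCount C D c t := by
  simp only [weightedCount, mul_smul]
  exact (summable_smul_countProb C D hc t).tsum_const_smul a

/-- Differentiation under the sum; reindexing the `D` term moves the shift from the probabilities to
the weights. -/
theorem hasDerivAt_weightedCount {c : ℕ → ℝ} (hc : GeomBounded c) (t : ℝ) :
    HasDerivAt (weightedCount C D c)
      (C *ᵥ weightedCount C D c t + D *ᵥ weightedCount C D (fun k => c (k + 1)) t) t := by
  let LC := C.mulVecLin.toContinuousLinearMap
  let LD := D.mulVecLin.toContinuousLinearMap
  -- `q k` is `countProb (k - 1)`, with `q 0 = 0`, so that one formula covers the equations for `k =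
  -- 0` and for successors.
  let q : ℕ → ℝ → Fin p → ℝ := fun k t => Nat.rec 0 (fun j _ => countProb C D j t) k
  let T := |t| + 1
  have hT : 0 ≤ T := by positivity
  obtain ⟨A, x, hA, hx, hbd⟩ := exists_norm_countProb_le_of_abs_le C D T hT
  let b : ℕ → ℝ := fun k => A * (x ^ k / k.factorial)
  let b' : ℕ → ℝ := fun k => Nat.rec 0 (fun j _ => b j) k
  have hq : ∀ k s, |s| ≤ T → ‖q k s‖ ≤ b' k := by
    intro k s hs
    cases k with
    | zero => simp [q, b']
    | succ k => exact hbd k s hs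
  have hu1 : Summable fun k => |c k| * b k := hc.summable_mul A x hA hx
  have hu2 : Summable fun k => |c k| * b' k :=
    (summable_nat_add_iff 1).mp (hc.shift.summable_mul A x hA hx)
  have hu : Summable fun k => ‖LC‖ * (|c k| * b k) + ‖LD‖ * (|c k| * b' k) :=
    (hu1.mul_left _).add (hu2.mul_left _)
  have hder : ∀ k s, s ∈ Metric.ball (0 : ℝ) T → HasDerivAt (fun s => c k • countProb C D k s)
      (LC (c k • countProb C D k s) + LD (c k • q k s)) s := by
    intro k s _
    cases k with
    | zero =>
      have := (hasDerivAt_countProb_zero C D s).const_smul (c 0)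
      exact this.congr_deriv (by simp [LC, LD, q])
    | succ k =>
      have := (hasDerivAt_countProb_succ C D k s).const_smul (c (k + 1))
      exact this.congr_deriv (by simp [LC, LD, q])
  have habs : ∀ s ∈ Metric.ball (0 : ℝ) T, |s| ≤ T := fun s hs => by
    simpa using (mem_ball_zero_iff.mp hs).le
  have hle : ∀ k s, s ∈ Metric.ball (0 : ℝ) T →
      ‖LC (c k • countProb C D k s) + LD (c k • q k s)‖
        ≤ ‖LC‖ * (|c k| * b k) + ‖LD‖ * (|c k| * b' k) := by
    intro k s hs
    refine (norm_add_le _ _).trans (add_le_add ?_ ?_)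
    · refine (LC.le_opNorm _).trans (mul_le_mul_of_nonneg_left ?_ (norm_nonneg _))
      rw [norm_smul]
      exact mul_le_mul_of_nonneg_left (hbd k s (habs s hs)) (abs_nonneg _)
    · refine (LD.le_opNorm _).trans (mul_le_mul_of_nonneg_left ?_ (norm_nonneg _))
      rw [norm_smul]
      exact mul_le_mul_of_nonneg_left (hq k s (habs s hs)) (abs_nonneg _)
  have ht : t ∈ Metric.ball (0 : ℝ) T := by simp [T]
  have key := hasDerivAt_tsum_of_isPreconnected hu Metric.isOpen_ball
    (convex_ball (0 : ℝ) T).isPreconnected hder hle ht (summable_smul_countProb C D hc t) ht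
  have hs1 := summable_smul_countProb C D hc t
  have hs2' := summable_smul_countProb C D hc.shift t
  have hs2 : Summable fun k => c k • q k t := (summable_nat_add_iff 1).mp hs2'
  have hval : ∑' k, (LC (c k • countProb C D k t) + LD (c k • q k t))
      = C *ᵥ weightedCount C D c t + D *ᵥ weightedCount C D (fun k => c (k + 1)) t := by
    rw [(LC.summable hs1).tsum_add (LD.summable hs2), ← LC.map_tsum hs1, ← LD.map_tsum hs2,
      hs2.tsum_eq_zero_add]
    simp [LC, LD, q, weightedCount]
  rw [← hval]
  exact key

/-- The Kolmogorov backward equation for the total mass. -/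
theorem hasDerivAt_weightedCount_one (t : ℝ) :
    HasDerivAt (weightedCount C D fun _ => 1) ((C + D) *ᵥ weightedCount C D (fun _ => 1) t) t := by
  rw [Matrix.add_mulVec]
  exact hasDerivAt_weightedCount C D geomBounded_one t

/-- The backward equation for the first moment. -/
theorem hasDerivAt_weightedCount_natCast (t : ℝ) :
    HasDerivAt (weightedCount C D fun k => k)
      ((C + D) *ᵥ weightedCount C D (fun k => k) t + D *ᵥ weightedCount C D (fun _ => 1) t) t := by
  have h := hasDerivAt_weightedCount C D geomBounded_natCast t
  simp only [Nat.cast_add, Nat.cast_one] at h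
  rw [weightedCount_add C D geomBounded_natCast geomBounded_one, Matrix.mulVec_add,
    ← add_assoc] at h
  rwa [Matrix.add_mulVec]

/-- The backward equation for the second moment. -/
theorem hasDerivAt_weightedCount_natCast_sq (t : ℝ) :
    HasDerivAt (weightedCount C D fun k => (k : ℝ) ^ 2)
      ((C + D) *ᵥ weightedCount C D (fun k => (k : ℝ) ^ 2) t
        + (2 : ℝ) • D *ᵥ weightedCount C D (fun k => k) t
        + D *ᵥ weightedCount C D (fun _ => 1) t) t := by
  have h := hasDerivAt_weightedCount C D geomBounded_natCast_sq t
  have h2 : (fun k : ℕ => ((k + 1 : ℕ) : ℝ) ^ 2) = fun k : ℕ => (k : ℝ) ^ 2 + (2 * (k : ℝ) + 1) := by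
    ext k; push_cast; ring
  have hg : GeomBounded fun k => 2 * (k : ℝ) :=
    ⟨2, 2, zero_le_two, zero_le_two, fun k => by
      have h : (k : ℝ) ≤ 2 ^ k := by exact_mod_cast (Nat.lt_two_pow_self (n := k)).le
      rw [abs_of_nonneg (by positivity)]
      linarith⟩
  have hg' : GeomBounded fun k => 2 * (k : ℝ) + 1 :=
    ⟨3, 2, by norm_num, zero_le_two, fun k => by
      have h : (k : ℝ) ≤ 2 ^ k := by exact_mod_cast (Nat.lt_two_pow_self (n := k)).le
      have h1 : (1 : ℝ) ≤ 2 ^ k := one_le_pow₀ one_le_two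
      rw [abs_of_nonneg (by positivity)]
      linarith⟩
  rw [h2, weightedCount_add C D geomBounded_natCast_sq hg', weightedCount_add C D hg geomBounded_one,
    weightedCount_const_mul C D 2 geomBounded_natCast, Matrix.mulVec_add, Matrix.mulVec_add,
    Matrix.mulVec_smul] at h
  convert h using 1
  rw [Matrix.add_mulVec]
  abel

end WeightedCount

/-! ### Energy estimates for `f' = Q f` and its perturbations -/

section Asymptotics

variable {p : ℕ} {Q : Matrix (Fin p) (Fin p) ℝ} {w : Fin p → ℝ}

theorem IsStationary.exists_norm_sq_le (hw : IsStationary Q w) :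
    ∃ K, 0 ≤ K ∧ ∀ f : Fin p → ℝ, ‖f‖ ^ 2 ≤ K * wInner w f f := by
  have hK : 0 ≤ ∑ i, (w i)⁻¹ := Finset.sum_nonneg fun i _ => (inv_pos.mpr (hw.pos i)).le
  refine ⟨∑ i, (w i)⁻¹, hK, fun f => ?_⟩
  have hE := hw.wInner_self_nonneg f
  have h0 : 0 ≤ (∑ i, (w i)⁻¹) * wInner w f f := mul_nonneg hK hE
  have h1 : ‖f‖ ≤ √((∑ i, (w i)⁻¹) * wInner w f f) := by
    refine (pi_norm_le_iff_of_nonneg (Real.sqrt_nonneg _)).mpr fun i => ?_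
    refine Real.le_sqrt_of_sq_le ?_
    have h2 : w i * (f i * f i) ≤ wInner w f f :=
      Finset.single_le_sum (f := fun i => w i * (f i * f i))
        (fun i _ => mul_nonneg (hw.pos i).le (mul_self_nonneg _)) (Finset.mem_univ i)
    have h3 : (w i)⁻¹ ≤ ∑ i, (w i)⁻¹ :=
      Finset.single_le_sum (f := fun i => (w i)⁻¹)
        (fun i _ => (inv_pos.mpr (hw.pos i)).le) (Finset.mem_univ i)
    calc ‖f i‖ ^ 2 = (w i)⁻¹ * (w i * (f i * f i)) := by
          have := (hw.pos i).ne'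
          rw [Real.norm_eq_abs, sq_abs]
          field_simp
      _ ≤ (w i)⁻¹ * wInner w f f := mul_le_mul_of_nonneg_left h2 (inv_pos.mpr (hw.pos i)).le
      _ ≤ _ := mul_le_mul_of_nonneg_right h3 hE
  calc ‖f‖ ^ 2 ≤ √((∑ i, (w i)⁻¹) * wInner w f f) ^ 2 := pow_le_pow_left₀ (norm_nonneg _) h1 2
    _ = _ := Real.sq_sqrt h0

theorem hasDerivAt_wInner_self {f : ℝ → Fin p → ℝ} {f' : Fin p → ℝ} {t : ℝ}
    (hf : HasDerivAt f f' t) :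
    HasDerivAt (fun s => wInner w (f s) (f s)) (2 * wInner w (f t) f') t := by
  have h : ∀ i, HasDerivAt (fun s => f s i) (f' i) t := hasDerivAt_pi.mp hf
  unfold wInner
  refine (HasDerivAt.fun_sum fun i _ => ((h i).mul (h i)).const_mul (w i)).congr_deriv ?_
  rw [Finset.mul_sum]
  exact Finset.sum_congr rfl fun i _ => by ring

theorem hasDerivAt_dotProduct {f : ℝ → Fin p → ℝ} {f' : Fin p → ℝ} {t : ℝ} (v : Fin p → ℝ)
    (hf : HasDerivAt f f' t) : HasDerivAt (fun s => v ⬝ᵥ f s) (v ⬝ᵥ f') t := by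
  have h : ∀ i, HasDerivAt (fun s => f s i) (f' i) t := hasDerivAt_pi.mp hf
  unfold dotProduct
  exact HasDerivAt.fun_sum fun i _ => (h i).const_mul (v i)

theorem le_initial_of_hasDerivAt_nonpos {g g' : ℝ → ℝ} (h : ∀ t, 0 ≤ t → HasDerivAt g (g' t) t)
    (hle : ∀ t, 0 ≤ t → g' t ≤ 0) {t : ℝ} (ht : 0 ≤ t) : g t ≤ g 0 := by
  have hanti : AntitoneOn g (Set.Ici 0) := by
    refine antitoneOn_of_deriv_nonpos (convex_Ici 0)
      (fun s hs => (h s hs).continuousAt.continuousWithinAt)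
      (fun s hs => (h s (interior_subset hs)).differentiableAt.differentiableWithinAt)
      fun s hs => ?_
    rw [(h s (interior_subset hs)).deriv]
    exact hle s (interior_subset hs)
  exact hanti Set.self_mem_Ici ht ht

/-- Solutions of `f' = Q f` that vanish at `0` vanish on `[0, ∞)`. -/
theorem IsStationary.eq_zero_of_hasDerivAt (hw : IsStationary Q w)
    (hQ : IsIrreducibleGenerator Q) {f : ℝ → Fin p → ℝ}
    (hf : ∀ t, 0 ≤ t → HasDerivAt f (Q *ᵥ f t) t) (h0 : f 0 = 0) {t : ℝ} (ht : 0 ≤ t) : f t = 0 := by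
  have h1 := le_initial_of_hasDerivAt_nonpos (fun t ht => hasDerivAt_wInner_self (w := w) (hf t ht))
    (fun t _ => by linarith [hw.wInner_mulVec_self_nonpos hQ (f t)]) ht
  have h2 : wInner w (f 0) (f 0) = 0 := by simp [h0, wInner]
  obtain ⟨K, hK, hle⟩ := hw.exists_norm_sq_le
  have h3 : ‖f t‖ ^ 2 ≤ 0 := (hle _).trans (mul_nonpos_of_nonneg_of_nonpos hK (h2 ▸ h1))
  exact norm_eq_zero.mp (pow_eq_zero_iff two_ne_zero |>.mp (le_antisymm h3 (sq_nonneg _)))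

/-- Exponential ergodicity. -/
theorem IsStationary.exists_norm_sq_le_exp (hw : IsStationary Q w)
    (hQ : IsIrreducibleGenerator Q) {f : ℝ → Fin p → ℝ}
    (hf : ∀ t, 0 ≤ t → HasDerivAt f (Q *ᵥ f t) t) (h0 : w ⬝ᵥ f 0 = 0) :
    ∃ γ K : ℝ, 0 < γ ∧ 0 ≤ K ∧ ∀ t, 0 ≤ t → ‖f t‖ ^ 2 ≤ K * Real.exp (-(2 * γ * t)) := by
  obtain ⟨γ, hγ, hgap⟩ := hw.exists_spectral_gap hQ
  obtain ⟨K, hK, hle⟩ := hw.exists_norm_sq_le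
  -- `w·f` is conserved since `wQ = 0`, so `f` stays where the spectral gap applies.
  have hdot : ∀ t, 0 ≤ t → w ⬝ᵥ f t = 0 := by
    have hd : ∀ t, 0 ≤ t → HasDerivAt (fun s => w ⬝ᵥ f s) 0 t := fun t ht => by
      simpa [hw.dotProduct_mulVec] using hasDerivAt_dotProduct w (hf t ht)
    intro t ht
    have h1 := le_initial_of_hasDerivAt_nonpos hd (fun _ _ => le_rfl) ht
    have h2 := le_initial_of_hasDerivAt_nonpos (fun t ht => (hd t ht).neg) (fun _ _ => by simp) ht
    simp only [Pi.neg_apply] at h2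
    linarith
  have hexp : ∀ t : ℝ, HasDerivAt (fun s => Real.exp (2 * γ * s))
      (Real.exp (2 * γ * t) * (2 * γ)) t := fun t => by
    simpa using ((hasDerivAt_id t).const_mul (2 * γ)).exp
  refine ⟨γ, K * wInner w (f 0) (f 0), hγ, mul_nonneg hK (hw.wInner_self_nonneg _),
    fun t ht => ?_⟩
  have h1 := le_initial_of_hasDerivAt_nonpos
    (fun t ht => (hasDerivAt_wInner_self (w := w) (hf t ht)).mul (hexp t)) (fun s hs => by
      have h2 := hgap (f s) (hdot s hs)
      have h3 := Real.exp_pos (2 * γ * s)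
      have h4 : 2 * wInner w (f s) (Q *ᵥ f s) + 2 * γ * wInner w (f s) (f s) ≤ 0 := by linarith
      calc _ = Real.exp (2 * γ * s)
            * (2 * wInner w (f s) (Q *ᵥ f s) + 2 * γ * wInner w (f s) (f s)) := by ring
        _ ≤ 0 := mul_nonpos_of_nonneg_of_nonpos h3.le h4) ht
  simp only [Pi.mul_apply, mul_zero, Real.exp_zero, mul_one] at h1
  rw [mul_assoc]
  refine (hle _).trans (mul_le_mul_of_nonneg_left ?_ hK)
  rwa [Real.exp_neg, ← div_eq_mul_inv, le_div_iff₀ (Real.exp_pos _)]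

theorem IsStationary.two_mul_wInner_le (hw : IsStationary Q w) (f g : Fin p → ℝ) {a : ℝ}
    (ha : 0 < a) : 2 * wInner w f g ≤ a * wInner w f f + a⁻¹ * wInner w g g := by
  simp only [wInner, Finset.mul_sum, ← Finset.sum_add_distrib]
  refine Finset.sum_le_sum fun i _ => ?_
  have h1 : 0 ≤ w i * (a⁻¹ * (a * f i - g i) ^ 2) :=
    mul_nonneg (hw.pos i).le (mul_nonneg (inv_pos.mpr ha).le (sq_nonneg _))
  have h2 : w i * (a⁻¹ * (a * f i - g i) ^ 2)
      = a * (w i * (f i * f i)) + a⁻¹ * (w i * (g i * g i)) - 2 * (w i * (f i * g i)) := by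
    field_simp
    ring
  linarith

/-- A solution of `r' = Q r + h` is bounded when `h` decays exponentially. -/
theorem IsStationary.exists_norm_le_of_hasDerivAt (hw : IsStationary Q w)
    (hQ : IsIrreducibleGenerator Q) {r h : ℝ → Fin p → ℝ}
    (hr : ∀ t, 0 ≤ t → HasDerivAt r (Q *ᵥ r t + h t) t) {γ K : ℝ} (hγ : 0 < γ) (hK : 0 ≤ K)
    (hh : ∀ t, 0 ≤ t → ‖h t‖ ^ 2 ≤ K * Real.exp (-(2 * γ * t))) :
    ∃ M, ∀ t, 0 ≤ t → ‖r t‖ ≤ M := by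
  obtain ⟨K', hK', hle⟩ := hw.exists_norm_sq_le
  -- Integrating factor for `E' ≤ exp (-γt) (E + K)`, where `E` is the weighted energy of `r`. The
  -- inequality comes from Young's inequality with weight `a = exp (-γt)`.
  have hexp : ∀ t : ℝ, HasDerivAt (fun s => Real.exp (Real.exp (-(γ * s)) / γ))
      (Real.exp (Real.exp (-(γ * t)) / γ) * (-Real.exp (-(γ * t)))) t := fun t => by
    have h1 := ((((hasDerivAt_id t).const_mul γ).neg.exp).div_const γ).exp
    refine h1.congr_deriv ?_
    simp only [id, mul_one, Pi.neg_apply]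
    field_simp
  let G : ℝ := (wInner w (r 0) (r 0) + K) * Real.exp (Real.exp (-(γ * 0)) / γ)
  refine ⟨√(K' * G), fun t ht => Real.le_sqrt_of_sq_le ((hle _).trans
    (mul_le_mul_of_nonneg_left ?_ hK'))⟩
  have h1 := le_initial_of_hasDerivAt_nonpos
    (fun t ht => ((hasDerivAt_wInner_self (w := w) (hr t ht)).add_const K).mul (hexp t)) (fun s hs => by
      have h2 := hw.wInner_mulVec_self_nonpos hQ (r s)
      have h3 := hw.two_mul_wInner_le (r s) (h s) (Real.exp_pos (-(γ * s)))
      have h4 := (hw.wInner_self_le (h s)).trans (hh s hs)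
      have h5 : (Real.exp (-(γ * s)))⁻¹ * wInner w (h s) (h s) ≤ Real.exp (-(γ * s)) * K := by
        rw [inv_mul_le_iff₀ (Real.exp_pos _)]
        refine h4.trans_eq ?_
        rw [← mul_assoc, ← Real.exp_add, mul_comm]
        ring_nf
      have h6 : wInner w (r s) (Q *ᵥ r s + h s)
          = wInner w (r s) (Q *ᵥ r s) + wInner w (r s) (h s) := by
        simp only [wInner, Pi.add_apply, ← Finset.sum_add_distrib]
        exact Finset.sum_congr rfl fun i _ => by ring
      have h7 := Real.exp_pos (Real.exp (-(γ * s)) / γ)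
      rw [h6]
      calc _ = Real.exp (Real.exp (-(γ * s)) / γ)
            * (2 * (wInner w (r s) (Q *ᵥ r s) + wInner w (r s) (h s))
              - Real.exp (-(γ * s)) * (wInner w (r s) (r s) + K)) := by ring
        _ ≤ 0 := mul_nonpos_of_nonneg_of_nonpos h7.le (by linarith)) ht
  simp only [Pi.mul_apply] at h1
  have hE := hw.wInner_self_nonneg (r t)
  have h8 : (1 : ℝ) ≤ Real.exp (Real.exp (-(γ * t)) / γ) :=
    Real.one_le_exp (div_nonneg (Real.exp_pos _).le hγ.le)
  have h9 := le_mul_of_one_le_right (add_nonneg hE hK) h8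
  exact (le_add_of_nonneg_right hK).trans (h9.trans h1)

end Asymptotics

/-! ### The limiting dispersion and its sign -/

section Dispersion

variable {p : ℕ} {C D : Matrix (Fin p) (Fin p) ℝ} {w : Fin p → ℝ}

theorem tendsto_div_atTop_of_bounded {g : ℝ → ℝ} {M : ℝ} (h : ∀ t, 0 ≤ t → |g t| ≤ M) :
    Tendsto (fun t => g t / t) atTop (𝓝 0) := by
  have h1 : Tendsto (fun t : ℝ => M * t⁻¹) atTop (𝓝 0) := by
    simpa using tendsto_inv_atTop_zero.const_mul M
  refine squeeze_zero_norm' ?_ h1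
  filter_upwards [eventually_ge_atTop 0] with t ht
  rw [div_eq_mul_inv, norm_mul, Real.norm_eq_abs, Real.norm_eq_abs, abs_of_nonneg (inv_nonneg.mpr ht)]
  exact mul_le_mul_of_nonneg_right (h t ht) (inv_nonneg.mpr ht)

theorem abs_dotProduct_le (v f : Fin p → ℝ) : |v ⬝ᵥ f| ≤ (∑ i, |v i|) * ‖f‖ := by
  rw [dotProduct, Finset.sum_mul]
  refine (Finset.abs_sum_le_sum_abs _ _).trans (Finset.sum_le_sum fun i _ => ?_)
  rw [abs_mul]
  exact mul_le_mul_of_nonneg_left (norm_le_pi_norm f i) (abs_nonneg _)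

/-- No mass escapes to infinity: the defect solves `f' = Qf` with zero initial value. -/
theorem weightedCount_one_eq (h : IsMAPRates C D) (hw : IsStationary (C + D) w) {t : ℝ}
    (ht : 0 ≤ t) : weightedCount C D (fun _ => 1) t = fun _ => 1 := by
  have hQ := h.isIrreducibleGenerator
  have h1 := hw.eq_zero_of_hasDerivAt hQ
    (f := fun t => weightedCount C D (fun _ => 1) t - fun _ => (1 : ℝ)) (fun s _ => by
      rw [Matrix.mulVec_sub, hQ.mulVec_const, sub_zero]
      exact (hasDerivAt_weightedCount_one C D s).sub_const _)
    (by simp [weightedCount_zero]) ht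
  exact sub_eq_zero.mp h1

theorem exists_tendsto_dispersion (h : IsMAPRates C D) (hw : IsStationary (C + D) w)
    {η : Fin p → ℝ} (hη : ∑ i, η i = 1) {lam : ℝ} (hlam : w ⬝ᵥ (D *ᵥ fun _ => 1) = lam)
    (hpos : 0 < lam) :
    ∃ g : Fin p → ℝ, w ⬝ᵥ g = 0 ∧ (C + D) *ᵥ g = (fun _ => lam) - D *ᵥ (fun _ => 1) ∧
      Tendsto (fun t : ℝ => (η ⬝ᵥ weightedCount C D (fun k => (k : ℝ) ^ 2) t
          - (η ⬝ᵥ weightedCount C D (fun k => k) t) ^ 2)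
          / (η ⬝ᵥ weightedCount C D (fun k => k) t)) atTop
        (𝓝 (1 + 2 * (w ⬝ᵥ (D *ᵥ g)) / lam)) := by
  have hQ := h.isIrreducibleGenerator
  let e : Fin p → ℝ := fun _ => 1
  have hlam' : w ⬝ᵥ (D *ᵥ e) = lam := hlam
  have hwe : w ⬝ᵥ e = 1 := hw.dotProduct_const 1
  have hηe : η ⬝ᵥ e = 1 := by simpa [dotProduct, e] using hη
  have hQe : (C + D) *ᵥ e = 0 := hQ.mulVec_const 1
  obtain ⟨g, hg0, hg⟩ := hw.exists_mulVec_eq hQ (y := lam • e - D *ᵥ e) (by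
    rw [dotProduct_sub, dotProduct_smul, hwe, hlam']; simp)
  -- The only value for which the equation for `b` is solvable, i.e. its right-hand side pairs to
  -- zero with `w`.
  set c := 2 * (w ⬝ᵥ (D *ᵥ g)) + lam with hc
  obtain ⟨b, -, hb⟩ := hw.exists_mulVec_eq hQ
    (y := (2 * lam) • g + c • e - (2 : ℝ) • D *ᵥ g - D *ᵥ e) (by
      simp only [dotProduct_sub, dotProduct_add, dotProduct_smul, hwe, hlam', hg0, hc, smul_eq_mul]
      ring)
  let u : ℝ → Fin p → ℝ := weightedCount C D fun k => (k : ℝ)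
  let v : ℝ → Fin p → ℝ := weightedCount C D fun k => (k : ℝ) ^ 2
  -- `f` and `r` are the errors of the polynomial approximations to `u` and `v`; the choices of `g`,
  -- `c`, `b` leave `f' = Qf` and `r' = Qr - 2Df`.
  let f : ℝ → Fin p → ℝ := fun t => (t * lam) • e + g - u t
  let r : ℝ → Fin p → ℝ := fun t =>
    v t - ((t ^ 2 * lam ^ 2) • e + t • ((2 * lam) • g + c • e) + b)
  have hu : ∀ t, 0 ≤ t → HasDerivAt u ((C + D) *ᵥ u t + D *ᵥ e) t := fun t ht => by
    have := hasDerivAt_weightedCount_natCast C D t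
    rwa [weightedCount_one_eq h hw ht] at this
  have hv : ∀ t, 0 ≤ t →
      HasDerivAt v ((C + D) *ᵥ v t + (2 : ℝ) • D *ᵥ u t + D *ᵥ e) t := fun t ht => by
    have := hasDerivAt_weightedCount_natCast_sq C D t
    rwa [weightedCount_one_eq h hw ht] at this
  have hf : ∀ t, 0 ≤ t → HasDerivAt f ((C + D) *ᵥ f t) t := fun t ht => by
    have h1 := ((((hasDerivAt_id t).mul_const lam).smul_const e).add_const g).sub (hu t ht)
    refine h1.congr_deriv ?_
    simp only [f, Matrix.mulVec_sub, Matrix.mulVec_add, Matrix.mulVec_smul, hQe, hg]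
    module
  have hr : ∀ t, 0 ≤ t →
      HasDerivAt r ((C + D) *ᵥ r t + (-(2 : ℝ)) • D *ᵥ f t) t := fun t ht => by
    have h1 := (hv t ht).sub ((((((hasDerivAt_id t).pow 2).mul_const (lam ^ 2)).smul_const e).add
      ((hasDerivAt_id t).smul_const ((2 * lam) • g + c • e))).add_const b)
    refine h1.congr_deriv ?_
    simp only [r, f, Matrix.mulVec_sub, Matrix.mulVec_add, Matrix.mulVec_smul, hQe, hg, hb, id]
    push_cast
    module
  have hf0 : w ⬝ᵥ f 0 = 0 := by
    have : u 0 = 0 := by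
      ext i
      simp [u, weightedCount_zero]
    simp [f, this, hg0]
  obtain ⟨γ, K, hγ, hK, hfK⟩ := hw.exists_norm_sq_le_exp hQ hf hf0
  let L := ((-(2 : ℝ)) • D.mulVecLin).toContinuousLinearMap
  obtain ⟨M, hM⟩ := hw.exists_norm_le_of_hasDerivAt hQ hr (K := ‖L‖ ^ 2 * K) hγ
    (by positivity) (fun t ht => by
      have h1 : ‖L (f t)‖ ^ 2 ≤ (‖L‖ * ‖f t‖) ^ 2 :=
        pow_le_pow_left₀ (norm_nonneg _) (L.le_opNorm _) 2
      calc ‖(-(2 : ℝ)) • D *ᵥ f t‖ ^ 2 = ‖L (f t)‖ ^ 2 := by simp [L]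
        _ ≤ ‖L‖ ^ 2 * ‖f t‖ ^ 2 := by rwa [← mul_pow]
        _ ≤ ‖L‖ ^ 2 * (K * Real.exp (-(2 * γ * t))) :=
            mul_le_mul_of_nonneg_left (hfK t ht) (sq_nonneg _)
        _ = _ := by ring)
  have hfto : Tendsto f atTop (𝓝 0) := by
    rw [tendsto_zero_iff_norm_tendsto_zero]
    have h1 : Tendsto (fun t : ℝ => K * Real.exp (-(2 * γ * t))) atTop (𝓝 0) := by
      have h2 : Tendsto (fun t : ℝ => 2 * γ * t) atTop atTop :=
        tendsto_id.const_mul_atTop (by positivity)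
      simpa using (Real.tendsto_exp_neg_atTop_nhds_zero.comp h2).const_mul K
    have h3 : Tendsto (fun t => ‖f t‖ ^ 2) atTop (𝓝 0) :=
      squeeze_zero' (Eventually.of_forall fun t => sq_nonneg _)
        ((eventually_ge_atTop 0).mono hfK) h1
    simpa using h3.sqrt
  have hηf : Tendsto (fun t => η ⬝ᵥ f t) atTop (𝓝 0) := by
    have hcont : Continuous fun x : Fin p → ℝ => η ⬝ᵥ x := by unfold dotProduct; fun_prop
    simpa [Function.comp_def] using (hcont.tendsto 0).comp hfto
  have hηr : Tendsto (fun t => (η ⬝ᵥ r t) / t) atTop (𝓝 0) :=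
    tendsto_div_atTop_of_bounded (M := (∑ i, |η i|) * M) fun t ht =>
      (abs_dotProduct_le η (r t)).trans (mul_le_mul_of_nonneg_left (hM t ht)
        (Finset.sum_nonneg fun i _ => abs_nonneg _))
  have hinv := tendsto_inv_atTop_zero (𝕜 := ℝ)
  have hmean : ∀ t, η ⬝ᵥ u t = t * lam + η ⬝ᵥ g - η ⬝ᵥ f t := fun t => by
    simp only [f, dotProduct_sub, dotProduct_add, dotProduct_smul, hηe, smul_eq_mul]
    ring
  have hsq : ∀ t, η ⬝ᵥ v t = t ^ 2 * lam ^ 2 + t * (2 * lam * (η ⬝ᵥ g) + c) + η ⬝ᵥ b + η ⬝ᵥ r t :=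
    fun t => by
      simp only [r, dotProduct_sub, dotProduct_add, dotProduct_smul, hηe, smul_eq_mul]
      ring
  have hden : Tendsto (fun t => (η ⬝ᵥ u t) / t) atTop (𝓝 lam) := by
    have h1 : Tendsto (fun t => lam + (η ⬝ᵥ g - η ⬝ᵥ f t) * t⁻¹) atTop
        (𝓝 (lam + (η ⬝ᵥ g - 0) * 0)) := ((hηf.const_sub _).mul hinv).const_add lam
    rw [mul_zero, add_zero] at h1
    refine h1.congr' ?_
    filter_upwards [eventually_gt_atTop 0] with t ht
    rw [hmean]
    field_simp
    ring
  -- The terms `t²λ²` and `2λt(η·g)` cancel, so the limit does not depend on `η`.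
  have hnum : Tendsto (fun t => (η ⬝ᵥ v t - (η ⬝ᵥ u t) ^ 2) / t) atTop (𝓝 c) := by
    have h1 : Tendsto (fun t => c + 2 * lam * (η ⬝ᵥ f t)
        + (η ⬝ᵥ b - (η ⬝ᵥ g - η ⬝ᵥ f t) ^ 2) * t⁻¹ + (η ⬝ᵥ r t) / t) atTop
        (𝓝 (c + 2 * lam * 0 + (η ⬝ᵥ b - (η ⬝ᵥ g - 0) ^ 2) * 0 + 0)) :=
      (((hηf.const_mul (2 * lam)).const_add c).add
        ((((hηf.const_sub _).pow 2).const_sub _).mul hinv)).add hηr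
    rw [mul_zero, mul_zero, add_zero, add_zero, add_zero] at h1
    refine h1.congr' ?_
    filter_upwards [eventually_gt_atTop 0] with t ht
    rw [hmean, hsq]
    field_simp
    ring
  refine ⟨g, hg0, ?_, ?_⟩
  · rw [hg]
    ext i
    simp [e]
  · have h1 := hnum.div hden hpos.ne'
    have h2 : c / lam = 1 + 2 * (w ⬝ᵥ (D *ᵥ g)) / lam := by
      rw [hc]
      field_simp
      ring
    rw [h2] at h1
    refine h1.congr' ?_
    filter_upwards [eventually_gt_atTop 0] with t ht
    exact div_div_div_cancel_right₀ ht.ne' _ _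

/-- Diagonality turns `w·Dg` into `⟨De, g⟩_w`; substituting `De = λe - Qg` and `w·g = 0` leaves the
Dirichlet form of `g`. -/
theorem dotProduct_mulVec_nonneg (h : IsMAPRates C D) (hw : IsStationary (C + D) w)
    (hdiag : D.IsDiag ∨ C.IsDiag) {lam : ℝ} {g : Fin p → ℝ} (hg0 : w ⬝ᵥ g = 0)
    (hg : (C + D) *ᵥ g = (fun _ => lam) - D *ᵥ (fun _ => 1)) : 0 ≤ w ⬝ᵥ (D *ᵥ g) := by
  have hQ := h.isIrreducibleGenerator
  have hdiag_mulVec : ∀ {A : Matrix (Fin p) (Fin p) ℝ}, A.IsDiag → ∀ (x : Fin p → ℝ) (i : Fin p),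
      (A *ᵥ x) i = (A *ᵥ fun _ => 1) i * x i := by
    intro A hA x i
    have hoff : ∀ j, j ≠ i → A i j = 0 := fun j hj => hA hj.symm
    simp only [Matrix.mulVec, dotProduct]
    rw [Finset.sum_eq_single i (fun j _ hj => by rw [hoff j hj, zero_mul]) (by simp),
      Finset.sum_eq_single i (fun j _ hj => by rw [hoff j hj, zero_mul]) (by simp), mul_one]
  have hform : w ⬝ᵥ (D *ᵥ g) = ∑ i, w i * ((D *ᵥ fun _ => 1) i * g i) := by
    rcases hdiag with hD | hC
    · exact Finset.sum_congr rfl fun i _ => by rw [hdiag_mulVec hD g i]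
    -- When `C` is diagonal, stationarity trades `D` for `-C`, and `Ce = -De` returns to the same
    -- sum.
    · have h1 : w ⬝ᵥ (D *ᵥ g) = -(w ⬝ᵥ (C *ᵥ g)) := by
        have := hw.dotProduct_mulVec g
        rw [Matrix.add_mulVec, dotProduct_add] at this
        linarith
      rw [h1, dotProduct, ← Finset.sum_neg_distrib]
      refine Finset.sum_congr rfl fun i _ => ?_
      have h2 := congrFun (hQ.mulVec_const 1) i
      rw [Matrix.add_mulVec, Pi.add_apply, Pi.zero_apply] at h2
      rw [hdiag_mulVec hC g i, eq_neg_of_add_eq_zero_left h2]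
      ring
  have h1 : w ⬝ᵥ (D *ᵥ g) = lam * (w ⬝ᵥ g) - wInner w g ((C + D) *ᵥ g) := by
    rw [hform, dotProduct, wInner, Finset.mul_sum, ← Finset.sum_sub_distrib]
    refine Finset.sum_congr rfl fun i _ => ?_
    rw [hg, Pi.sub_apply]
    ring
  rw [h1, hg0]
  linarith [hw.wInner_mulVec_self_nonpos hQ g]

theorem dotProduct_mulVec_one_pos (h : IsMAPRates C D) (hw : IsStationary (C + D) w)
    (hD : D ≠ 0) : 0 < w ⬝ᵥ (D *ᵥ fun _ => 1) := by
  obtain ⟨i, j, hij⟩ : ∃ i j, D i j ≠ 0 := by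
    by_contra! hc
    exact hD (Matrix.ext hc)
  simp only [dotProduct, Matrix.mulVec, mul_one]
  refine Finset.sum_pos' (fun i _ => mul_nonneg (hw.pos i).le
    (Finset.sum_nonneg fun j _ => h.D_nonneg i j)) ⟨i, Finset.mem_univ i, mul_pos (hw.pos i) ?_⟩
  exact Finset.sum_pos' (fun j _ => h.D_nonneg i j)
    ⟨j, Finset.mem_univ j, (h.D_nonneg i j).lt_of_ne' hij⟩

end Dispersion

/-! ### From finite-dimensional distributions to moments of `N t` -/

section Law

variable {p : ℕ} {C D : Matrix (Fin p) (Fin p) ℝ} {η : Fin p → ℝ}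
  {Ω : Type*} [MeasurableSpace Ω] {μ : Measure Ω} {N : ℝ≥0 → Ω → ℕ} {X : ℝ≥0 → Ω → Fin p}

theorem integrable_comp_nat [IsFiniteMeasure μ] {Y : Ω → ℕ} (hY : Measurable Y) (c : ℕ → ℝ)
    (hc : Summable fun k => μ.real {ω | Y ω = k} * |c k|) :
    Integrable (fun ω => c (Y ω)) μ ∧ ∫ ω, c (Y ω) ∂μ = ∑' k, μ.real {ω | Y ω = k} * c k := by
  have hreal : ∀ k, (μ.map Y).real {k} = μ.real {ω | Y ω = k} := fun k =>
    map_measureReal_apply hY (measurableSet_singleton k)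
  have hint : Integrable c (μ.map Y) := by
    rw [← Measure.sum_smul_dirac (μ.map Y)]
    refine integrable_sum_dirac (fun i => measure_ne_top _ _) ?_
    refine hc.congr fun k => ?_
    rw [← hreal, measureReal_def, Real.norm_eq_abs]
  refine ⟨hint.comp_measurable hY, ?_⟩
  have h1 : ∫ ω, c (Y ω) ∂μ = ∫ k, c k ∂(μ.map Y) :=
    (integral_map hY.aemeasurable hint.aestronglyMeasurable).symm
  rw [h1, integral_countable hint]
  simp only [hreal, smul_eq_mul]

theorem IsMAP.measureReal_init (h : IsMAP C D η μ N X) (n : ℕ) (i : Fin p) :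
    μ.real {ω | N 0 ω = n ∧ X 0 ω = i} = if n = 0 then η i else 0 := by
  have := h.law 0 (fun _ => 0) (fun _ => (n, i)) rfl monotone_const
  simpa using this

theorem IsMAP.measureReal_pair (h : IsMAP C D η μ N X) (t : ℝ≥0) (k : ℕ) (i j : Fin p) :
    μ.real {ω | (N 0 ω = 0 ∧ X 0 ω = i) ∧ N t ω = k ∧ X t ω = j}
      = η i * countTrans C D k t i j := by
  have hm : Monotone (![0, t] : Fin 2 → ℝ≥0) := by
    rw [Fin.monotone_iff_le_succ]
    simp
  have := h.law 1 ![0, t] ![(0, i), (k, j)] rfl hm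
  simpa [Fin.forall_fin_two, mapTrans] using this

theorem IsMAP.ae_init [IsProbabilityMeasure μ] (h : IsMAP C D η μ N X) : ∀ᵐ ω ∂μ, N 0 ω = 0 := by
  have hmeas : ∀ i, MeasurableSet {ω | N 0 ω = 0 ∧ X 0 ω = i} := fun i =>
    (h.measurable_N 0 (measurableSet_singleton 0)).inter
      (h.measurable_X 0 (measurableSet_singleton i))
  have h1 : μ.real {ω | N 0 ω = 0} = 1 := by
    have h2 : {ω | N 0 ω = 0} = ⋃ i ∈ (Finset.univ : Finset (Fin p)),
        {ω | N 0 ω = 0 ∧ X 0 ω = i} := by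
      ext ω; simp
    rw [h2, measureReal_biUnion_finset _ fun i _ => hmeas i]
    · simp [h.measureReal_init, h.init_mem.2]
    · intro i _ j _ hij
      exact Set.disjoint_left.mpr fun ω h1 h2 => hij (h1.2.symm.trans h2.2)
  have h0 : MeasurableSet {ω | N 0 ω = 0} := h.measurable_N 0 (measurableSet_singleton 0)
  rw [ae_iff_measure_eq h0.nullMeasurableSet, measure_univ]
  rwa [measureReal_def, ENNReal.toReal_eq_one_iff] at h1

/-- Up to the null event `N 0 ≠ 0`, the event splits over initial and terminal phases into two-time
events whose probabilities `law` prescribes. -/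
theorem IsMAP.measureReal_eq [IsProbabilityMeasure μ] (h : IsMAP C D η μ N X) (t : ℝ≥0) (k : ℕ) :
    μ.real {ω | N t ω = k} = η ⬝ᵥ countProb C D k t := by
  have hmeas : ∀ ij : Fin p × Fin p,
      MeasurableSet {ω | (N 0 ω = 0 ∧ X 0 ω = ij.1) ∧ N t ω = k ∧ X t ω = ij.2} := fun ij =>
    ((h.measurable_N 0 (measurableSet_singleton 0)).inter
      (h.measurable_X 0 (measurableSet_singleton ij.1))).inter
    ((h.measurable_N t (measurableSet_singleton k)).inter
      (h.measurable_X t (measurableSet_singleton ij.2)))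
  have h1 : μ.real {ω | N t ω = k} = μ.real (⋃ ij ∈ (Finset.univ : Finset (Fin p × Fin p)),
      {ω | (N 0 ω = 0 ∧ X 0 ω = ij.1) ∧ N t ω = k ∧ X t ω = ij.2}) := by
    refine measureReal_congr ?_
    filter_upwards [h.ae_init] with ω hω
    refine propext ⟨fun hk => ?_, fun hk => ?_⟩
    · exact Set.mem_biUnion (x := (X 0 ω, X t ω)) (Finset.mem_coe.mpr (Finset.mem_univ _))
        ⟨⟨hω, rfl⟩, hk, rfl⟩
    · obtain ⟨ij, _, hij⟩ := Set.mem_iUnion₂.mp hk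
      exact hij.2.1
  rw [h1, measureReal_biUnion_finset _ fun ij _ => hmeas ij, Fintype.sum_prod_type]
  · simp only [h.measureReal_pair, ← Finset.mul_sum]
    simp [countProb, dotProduct, Matrix.mulVec]
  · rintro ⟨i, j⟩ _ ⟨i', j'⟩ _ hij
    refine Set.disjoint_left.mpr fun ω h1 h2 => hij ?_
    exact Prod.ext (h1.1.2.symm.trans h2.1.2) (h1.2.2.symm.trans h2.2.2)

theorem IsMAP.integrable_and_integral_eq [IsProbabilityMeasure μ] (h : IsMAP C D η μ N X)
    (t : ℝ≥0) {c : ℕ → ℝ} (hc : GeomBounded c) :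
    Integrable (fun ω => c (N t ω)) μ ∧
      ∫ ω, c (N t ω) ∂μ = η ⬝ᵥ weightedCount C D c t := by
  have hs := summable_norm_smul_countProb C D hc (t : ℝ)
  have hterm : ∀ k, μ.real {ω | N t ω = k} * c k = η ⬝ᵥ (c k • countProb C D k t) := fun k => by
    rw [h.measureReal_eq, dotProduct_smul, smul_eq_mul, mul_comm]
  have hsum : Summable fun k => μ.real {ω | N t ω = k} * |c k| := by
    refine Summable.of_nonneg_of_le (fun k => by positivity) (fun k => ?_)
      (hs.mul_left (∑ i, |η i|))
    rw [← abs_of_nonneg (measureReal_nonneg (μ := μ) (s := {ω | N t ω = k})), ← abs_mul, hterm]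
    exact abs_dotProduct_le _ _
  obtain ⟨h1, h2⟩ := integrable_comp_nat (h.measurable_N t) c hsum
  refine ⟨h1, h2.trans ?_⟩
  simp only [hterm]
  have hs' := summable_smul_countProb C D hc (t : ℝ)
  have hs'' : ∀ i, Summable fun k => (c k • countProb C D k t) i := Pi.summable.mp hs'
  simp only [dotProduct, weightedCount]
  rw [Summable.tsum_finsetSum fun i _ => (hs'' i).mul_left (η i)]
  refine Finset.sum_congr rfl fun i _ => ?_
  rw [tsum_mul_left, tsum_apply hs']

theorem IsMAP.exists_hasDispersionLimit [IsProbabilityMeasure μ] (h : IsMAP C D η μ N X)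
    (hD : D ≠ 0) (hdiag : D.IsDiag ∨ C.IsDiag) : ∃ d2, HasDispersionLimit μ N d2 ∧ 1 ≤ d2 := by
  -- A stationary probability vector needs at least one phase; `D ≠ 0` provides it.
  have hp : p ≠ 0 := by
    rintro rfl
    exact hD (Matrix.ext fun i => i.elim0)
  have : NeZero p := ⟨hp⟩
  obtain ⟨w, hw⟩ := h.rates.isIrreducibleGenerator.exists_isStationary
  have hpos := dotProduct_mulVec_one_pos h.rates hw hD
  obtain ⟨g, hg0, hg, hlim⟩ := exists_tendsto_dispersion h.rates hw h.init_mem.2 rfl hpos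
  have hLp : ∀ t, MemLp (fun ω => (N t ω : ℝ)) 2 μ := fun t =>
    (memLp_two_iff_integrable_sq
      (measurable_from_top.comp (h.measurable_N t)).aestronglyMeasurable).mpr
      (h.integrable_and_integral_eq t geomBounded_natCast_sq).1
  refine ⟨_, ⟨hLp, ?_⟩, le_add_of_nonneg_right (div_nonneg (mul_nonneg zero_le_two
    (dotProduct_mulVec_nonneg h.rates hw hdiag hg0 hg)) hpos.le)⟩
  refine (hlim.comp (NNReal.tendsto_coe_atTop.mpr tendsto_id)).congr fun t => ?_
  have h1 := (h.integrable_and_integral_eq t geomBounded_natCast).2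
  have h2 := (h.integrable_and_integral_eq t geomBounded_natCast_sq).2
  rw [variance_eq_sub (hLp t)]
  simp only [Pi.pow_apply, h1, h2, Function.comp_apply, id]

end Law

end MarkovArrival

theorem mainTheorem7 {p : ℕ} (C D : Matrix (Fin p) (Fin p) ℝ) (η : Fin p → ℝ)
    {Ω : Type*} [MeasurableSpace Ω] (μ : Measure Ω) [IsProbabilityMeasure μ]
    (N : ℝ≥0 → Ω → ℕ) (X : ℝ≥0 → Ω → Fin p) (hD : D ≠ 0)
    (h : MarkovArrival.IsMMPP C D η μ N X ∨ MarkovArrival.IsMSPP C D η μ N X) :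
    ∃ d2 : ℝ, MarkovArrival.HasDispersionLimit μ N d2 ∧ 1 ≤ d2 := by
  rcases h with ⟨h, hdiag⟩ | ⟨h, hdiag⟩
  · exact h.exists_hasDispersionLimit hD (Or.inl hdiag)
  · exact h.exists_hasDispersionLimit hD (Or.inr hdiag)
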